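/- Let $\lambda$ be a regular uncountable cardinal, let $\mu = 2^{\lambda}$, and let $\kappa$ be the least cardinal such that $2^{\kappa} > \mu$. Then there is a Hausdorff topological space $X$ with a basis consisting of clopen sets and with $|X| = 2^{\kappa}$ such that every closed subset $Y \subseteq X$ with $|Y| < |X|$ satisfies $|Y| < \lambda$. -/

import Mathlib

universe u

/-!
The space is the set of well-founded trees `LimitTree L J` with `#L = lam` and `#J = 2 ^ kap`, where
a tree `node j g` is decreed to be a limit of the sequence `g` of its children whenever `g` is
injective. To each tree `η` an ultrafilter `D η` on `L` is attached, and the topology is generated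
by the sets `U` such that, for every such `η`, `η ∈ U` exactly when `D η`-most children of `η` are
in `U`. These sets form a Boolean algebra, so they are a clopen basis. A closed set with `lam`
points contains an injective `g : L → Y`, hence all `2 ^ kap` trees `node j g`; so closed sets
smaller than the space have fewer than `lam` points.

The work lies in choosing the ultrafilters so that there are enough such sets `U` to separate
points. Given two trees, take a set `S` of at most `lam` trees containing both and closed under
children. If each `η ∈ S` can be assigned a `D η`-large set of children such that the assigned sets
are pairwise disjoint and omit the two given trees, then the set of trees of `S` reached from one of
the two by descending along assigned children is compatible with all limits at trees in `S`, and
omits the other; it extends by recursion to all trees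
(`exists_isLimitCompatible_of_hereditary`, `exists_isLimitCompatible_separating`).

Disjointness comes from two sources. Number the trees of `S` by elements of `L`. On the closure
points of a suitable function, children with distinct indices are distinct as long as the indices
exceed the numbers of the parents (`exists_closurePoints_disjoint`), so each `D η` is chosen to
extend the club filter.
Children with the same index `i` are kept apart by a guess: there is a function `G i` of codes
such that every assignment `v` of values to codes is the `D`-limit of the `G i` for some ultrafilter
`D` extending the club filter (`exists_guessing`, `exists_ultrafilter_guessing`). This combines a
dense family of functions of Engelking and Karłowicz with a function on `L` all of whose fibers are
stationary, and it allows `2 ^ lam` codes. Since `lam < kap ≤ 2 ^ lam`, this many codes suffice to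
provide, for every set `S` as above, a code whose values number `S` injectively (`exists_codes`);
a child with index `i` is assigned to `η` only if `G i` guesses the value of `η` at that code.
-/

open Cardinal Set

/-! ### Closure points in a regular well-order -/

/-- A well-order of uncountable regular cardinality all of whose proper initial segments are
smaller: an order isomorphic to an uncountable regular initial ordinal. Regularity is expressed by
the existence of strict bounds for small families. -/
structure IsUncountableRegularOrder (L : Type u) [LinearOrder L] : Prop where
  wf : WellFoundedLT L
  aleph0_lt : ℵ₀ < #L
  mk_Iic_lt : ∀ a : L, #(Iic a) < #L
  exists_gt : ∀ {ι : Type u} (f : ι → L), #ι < #L → ∃ a, ∀ i, f i < a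

theorem isUncountableRegularOrder_ord {lam : Cardinal.{u}} (hreg : lam.IsRegular)
    (hunc : ℵ₀ < lam) : IsUncountableRegularOrder lam.ord.ToType where
  wf := inferInstance
  aleph0_lt := by simpa using hunc
  mk_Iic_lt a := by
    exact mk_Iic_lt a (by simp) (by simpa using hreg.aleph0_le)
  exists_gt f hf := by
    rw [mk_ord_toType] at hf
    by_contra! h
    have hc : IsCofinal (range f) := fun a => by
      obtain ⟨i, hi⟩ := h a
      exact ⟨f i, mem_range_self i, hi⟩
    have h1 := Order.cof_le hc
    rw [Ordinal.cof_toType, hreg.cof_ord] at h1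
    exact absurd (h1.trans mk_range_le) (not_le.2 hf)

/-- The elements `γ`, other than the least one, whose initial segment is closed under `F`. These
sets generate the filter of closed unbounded subsets of a regular order. -/
def closurePoints {L : Type u} [LinearOrder L] (F : L → L) : Set L :=
  {γ | (∃ i, i < γ) ∧ ∀ i < γ, F i < γ}

section Regular

variable {L : Type u} [LinearOrder L]

theorem closurePoints_anti {F G : L → L} (h : ∀ i, F i ≤ G i) :
    closurePoints G ⊆ closurePoints F :=
  fun _ hγ => ⟨hγ.1, fun i hi => (h i).trans_lt (hγ.2 i hi)⟩

namespace IsUncountableRegularOrder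

variable (hL : IsUncountableRegularOrder L)

include hL

theorem exists_gt_nat (f : ℕ → L) : ∃ a, ∀ n, f n < a := by
  obtain ⟨a, ha⟩ := hL.exists_gt (fun n : ULift.{u} ℕ => f n.down) (by simpa using hL.aleph0_lt)
  exact ⟨a, fun n => ha ⟨n⟩⟩

/-- Diagonal intersections: a single `F` captures closure under all sections of `G`. -/
theorem exists_closurePoints_diagonal (G : L → L → L → L) :
    ∃ F : L → L, ∀ γ ∈ closurePoints F, ∀ a < γ, ∀ b < γ, ∀ i < γ, G a b i < γ := by
  have h (m : L) : ∃ a, ∀ p : Iic m × Iic m × Iic m, G p.1 p.2.1 p.2.2 < a := by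
    refine hL.exists_gt _ ?_
    have h1 := hL.mk_Iic_lt m
    have h2 := hL.aleph0_lt.le
    simpa using mul_lt_of_lt h2 h1 (mul_lt_of_lt h2 h1 h1)
  choose F hF using h
  refine ⟨F, fun γ hγ a ha b hb i hi => ?_⟩
  refine lt_trans (hF (max a (max b i)) (⟨a, ?_⟩, ⟨b, ?_⟩, ⟨i, ?_⟩)) (hγ.2 _ ?_) <;> simp [*]

/-- Closure points of countable cofinality exist beyond every given element. -/
theorem exists_mem_closurePoints_cofinal_seq (F : L → L) (β : L) :
    ∃ γ ∈ closurePoints F, β < γ ∧ ∃ s : ℕ → L, (∀ n, s n < γ) ∧ ∀ i < γ, ∃ n, i ≤ s n := by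
  have h (m : L) : ∃ a, ∀ i : Iic m, max (i : L) (F i) < a := hL.exists_gt _ (hL.mk_Iic_lt m)
  choose F' hF' using h
  obtain ⟨a, ha⟩ := hL.exists_gt_nat (fun n => F'^[n] β)
  have := hL.wf
  have hne : {a | ∀ n, F'^[n] β < a}.Nonempty := ⟨a, ha⟩
  let γ := WellFounded.min wellFounded_lt {a | ∀ n, F'^[n] β < a} hne
  have hγ : ∀ n, F'^[n] β < γ := WellFounded.min_mem wellFounded_lt _ hne
  have hlt : ∀ i < γ, ∃ n, i ≤ F'^[n] β := by
    intro i hi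
    by_contra! hcon
    exact WellFounded.not_lt_min wellFounded_lt {a | ∀ n, F'^[n] β < a} (x := i) hcon hi
  refine ⟨γ, ⟨⟨β, hγ 0⟩, fun i hi => ?_⟩, hγ 0, _, hγ, hlt⟩
  obtain ⟨n, hn⟩ := hlt i hi
  refine ((le_max_right _ _).trans_lt (hF' _ ⟨i, hn⟩)).trans ?_
  exact Function.iterate_succ_apply' F' n β ▸ hγ (n + 1)

/-- A function taking each of its at most `#L` values on a stationary set, that is, at a closure
point of every `F`. -/
theorem exists_forall_stationary_fiber {W : Type u} [Nonempty W] (hW : #W ≤ #L) :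
    ∃ w : L → W, ∀ (F : L → L) (v : W), ∃ γ ∈ closurePoints F, w γ = v := by
  have h (γ : L) : ∃ l : ℕ → L,
      (∃ s : ℕ → L, (∀ n, s n < γ) ∧ ∀ i < γ, ∃ n, i ≤ s n) →
        (∀ n, l n < γ) ∧ ∀ i < γ, ∃ n, i ≤ l n := by
    by_cases h : ∃ s : ℕ → L, (∀ n, s n < γ) ∧ ∀ i < γ, ∃ n, i ≤ s n
    · exact ⟨h.choose, fun _ => h.choose_spec⟩
    · exact ⟨fun _ => γ, fun h' => absurd h' h⟩
  choose lad hlad using h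
  -- For some `n`, unboundedly many values of the `n`-th ladder entry have stationary fibers.
  have key : ∃ n, ∀ β, ∃ ζ ≥ β, ∀ F, ∃ γ ∈ closurePoints F, lad γ n = ζ := by
    by_contra! hcon
    choose b hb using hcon
    have hb' (n : ℕ) (ζ : L) : ∃ F : L → L, b n ≤ ζ → ∀ γ ∈ closurePoints F, lad γ n ≠ ζ := by
      by_cases h : b n ≤ ζ
      · obtain ⟨F, hF⟩ := hb n ζ h
        exact ⟨F, fun _ => hF⟩
      · exact ⟨id, fun h' => absurd h' h⟩
    choose FF hFF using hb'
    obtain ⟨β, hβ⟩ := hL.exists_gt_nat b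
    choose G hG using fun ζ i => hL.exists_gt_nat (fun n => FF n ζ i)
    obtain ⟨F, hF⟩ := hL.exists_closurePoints_diagonal (fun ζ _ i => G ζ i)
    obtain ⟨γ, hγ, hβγ, hs⟩ := hL.exists_mem_closurePoints_cofinal_seq F β
    obtain ⟨h1, h2⟩ := hlad γ hs
    obtain ⟨n, hn⟩ := h2 β hβγ
    exact hFF n (lad γ n) ((hβ n).le.trans hn) γ
      ⟨hγ.1, fun i hi => (hG _ i n).trans (hF γ hγ _ (h1 n) _ (h1 n) i hi)⟩ rfl
  obtain ⟨n, hn⟩ := key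
  set Z : Set L := {ζ | ∀ F, ∃ γ ∈ closurePoints F, lad γ n = ζ}
  have hZ : #L ≤ #Z := by
    by_contra! hlt
    obtain ⟨a, ha⟩ := hL.exists_gt (fun z : Z => (z : L)) hlt
    obtain ⟨ζ, hζ, hζ'⟩ := hn a
    exact absurd (ha ⟨ζ, hζ'⟩) (not_lt.2 hζ)
  obtain ⟨φ⟩ := hW.trans hZ
  have hφ : Function.Injective (fun v => (φ v : L)) := Subtype.val_injective.comp φ.injective
  refine ⟨fun γ => Function.invFun (fun v => (φ v : L)) (lad γ n), fun F v => ?_⟩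
  obtain ⟨γ, hγ, h⟩ := (φ v).2 F
  refine ⟨γ, hγ, ?_⟩
  simp only [h]
  exact Function.leftInverse_invFun hφ v

/-- Entries of `#L` many injective sequences `A ε` with distinct indices are distinct, provided that
the indices are closure points lying beyond the sequence numbers `ε`. -/
theorem exists_closurePoints_disjoint {X : Type u} (A : L → L → X) :
    ∃ F : L → L, ∀ ε ε' γ δ, (A ε).Injective → (A ε').Injective → γ ∈ closurePoints F →
      δ ∈ closurePoints F → ε < γ → ε' < δ → A ε γ = A ε' δ → γ = δ := by
  classical
  obtain ⟨F, hF⟩ := hL.exists_closurePoints_diagonal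
    (fun ε ε' i => if h : ∃ j, A ε' j = A ε i then h.choose else i)
  have main : ∀ ε ε' γ δ, (A ε').Injective → δ ∈ closurePoints F → ε < γ → ε' < δ →
      A ε γ = A ε' δ → ¬ γ < δ := by
    intro ε ε' γ δ hinj hδ hε hε' heq hlt
    have h := hF δ hδ ε (hε.trans hlt) ε' hε' γ hlt
    have hex : ∃ j, A ε' j = A ε γ := ⟨δ, heq.symm⟩
    rw [dif_pos hex, hinj (hex.choose_spec.trans heq)] at h
    exact lt_irrefl _ h
  refine ⟨F, fun ε ε' γ δ hi hi' hγ hδ hε hε' heq => ?_⟩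
  exact le_antisymm (not_lt.1 (main ε' ε δ γ hi hγ hε' hε heq.symm))
    (not_lt.1 (main ε ε' γ δ hi' hδ hε hε' heq))

end IsUncountableRegularOrder

end Regular

/-! ### Dense families of functions -/

/-- Engelking–Karłowicz: at most `#L` functions on `Set L` realize all finite patterns. -/
theorem exists_engelking_karlowicz (L : Type u) [Infinite L] :
    ∃ (W : Type u) (h : W → Set L → L), Nonempty W ∧ #W ≤ #L ∧
      ∀ (t : Finset (Set L)) (v : Set L → L), ∃ w, ∀ c ∈ t, h w c = v c := by
  classical
  let tr (c : Set L) (s : Finset L) : Finset L := {x ∈ s | x ∈ c}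
  have a₀ : L := Classical.arbitrary L
  refine ⟨Finset L × Finset (Finset L × L),
    fun w c => if h : ∃ ε, (tr c w.1, ε) ∈ w.2 then h.choose else a₀, inferInstance, ?_, ?_⟩
  · have h1 : #(Finset L) = #L := mk_finset_of_infinite L
    simp [h1]
  · intro t v
    -- A finite set `s` on which distinct members of `t` have distinct traces.
    have hd (c d : Set L) : ∃ x, c ≠ d → ¬ (x ∈ c ↔ x ∈ d) := by
      by_contra! hcon
      exact (hcon a₀).1 (Set.ext fun x => (hcon x).2)
    choose x hx using hd
    let s : Finset L := (t ×ˢ t).image fun p => x p.1 p.2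
    have hs : ∀ c ∈ t, ∀ d ∈ t, tr c s = tr d s → c = d := by
      intro c hc d hd h
      by_contra hne
      apply hx c d hne
      have hxs : x c d ∈ s := Finset.mem_image.2 ⟨(c, d), Finset.mk_mem_product hc hd, rfl⟩
      have := congrArg (x c d ∈ ·) h
      simpa [tr, hxs] using this
    refine ⟨(s, t.image fun c => (tr c s, v c)), fun c hc => ?_⟩
    have hex : ∃ ε, (tr c s, ε) ∈ t.image fun c => (tr c s, v c) :=
      ⟨v c, Finset.mem_image_of_mem (fun c => (tr c s, v c)) hc⟩
    simp only
    rw [dif_pos hex]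
    obtain ⟨d, hd, hde⟩ := Finset.mem_image.1 hex.choose_spec
    rw [Prod.mk.injEq] at hde
    rw [← hde.2, hs d hd c hc hde.1]

/-! ### Guessing functions and coding -/

theorem IsUncountableRegularOrder.infinite {L : Type u} [LinearOrder L]
    (hL : IsUncountableRegularOrder L) : Infinite L :=
  infinite_iff.2 hL.aleph0_lt.le

/-- A sequence of `#L` many functions `Code → L` realizing every finite pattern on a stationary
set of indices, provided that there are at most `2 ^ #L` codes. -/
theorem IsUncountableRegularOrder.exists_guessing {L : Type u} [LinearOrder L]
    (hL : IsUncountableRegularOrder L) {Code : Type u} [Nonempty Code] (hC : #Code ≤ 2 ^ #L) :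
    ∃ G : L → Code → L, ∀ (F : L → L) (t : Finset Code) (v : Code → L),
      ∃ γ ∈ closurePoints F, ∀ c ∈ t, G γ c = v c := by
  have := hL.infinite
  obtain ⟨W, h, _, hW, hh⟩ := exists_engelking_karlowicz L
  obtain ⟨w, hw⟩ := hL.exists_forall_stationary_fiber hW
  rw [← mk_set] at hC
  obtain ⟨φ⟩ := hC
  refine ⟨fun γ c => h (w γ) (φ c), fun F t v => ?_⟩
  obtain ⟨w₀, hw₀⟩ := hh (t.map φ) (v ∘ Function.invFun φ)
  obtain ⟨γ, hγ, hγw⟩ := hw F w₀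
  refine ⟨γ, hγ, fun c hc => ?_⟩
  simp only [hγw]
  rw [hw₀ _ (Finset.mem_map_of_mem φ hc)]
  simp [Function.leftInverse_invFun φ.injective c]

/-- The ultrafilters refine the club filter, and along them the guesses `G i c` converge to `v c`.
-/
theorem exists_ultrafilter_guessing {L Code : Type u} [LinearOrder L] {G : L → Code → L}
    (hG : ∀ (F : L → L) (t : Finset Code) (v : Code → L),
      ∃ γ ∈ closurePoints F, ∀ c ∈ t, G γ c = v c) (v : Code → L) :
    ∃ D : Ultrafilter L, (∀ F, closurePoints F ∈ D) ∧ ∀ c, ∀ᶠ i in (D : Filter L), G i c = v c := by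
  classical
  let B (p : (L → L) × Finset Code) : Set L := {γ | γ ∈ closurePoints p.1 ∧ ∀ c ∈ p.2, G γ c = v c}
  have hne : (⨅ p, Filter.principal (B p)).NeBot := by
    have : Nonempty ((L → L) × Finset Code) := ⟨id, ∅⟩
    refine Filter.iInf_neBot_of_directed' ?_ fun p => ?_
    · intro p q
      refine ⟨(fun i => max (p.1 i) (q.1 i), p.2 ∪ q.2), Filter.principal_mono.2 fun γ hγ => ?_,
        Filter.principal_mono.2 fun γ hγ => ?_⟩
      · exact ⟨closurePoints_anti (fun i => le_max_left _ _) hγ.1,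
          fun c hc => hγ.2 c (Finset.mem_union_left _ hc)⟩
      · exact ⟨closurePoints_anti (fun i => le_max_right _ _) hγ.1,
          fun c hc => hγ.2 c (Finset.mem_union_right _ hc)⟩
    · exact Filter.principal_neBot_iff.2 (hG p.1 p.2 v)
  have hB (p) : B p ∈ Ultrafilter.of (⨅ p, Filter.principal (B p)) :=
    Ultrafilter.of_le _ (Filter.mem_iInf_of_mem p (Filter.mem_principal_self _))
  refine ⟨_, fun F => Filter.mem_of_superset (hB (F, ∅)) fun γ hγ => hγ.1, fun c => ?_⟩
  exact Filter.mem_of_superset (hB (id, {c})) fun γ hγ => hγ.2 c (by simp)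

/-- At most `2 ^ #L` functions `val c : X → L` suffice to number every set of at most `#L` points
injectively. Regarding points as subsets of `K`, a code lists a coordinate in `K` for each pair of
indices, meant to separate the two points, and for each index the trace of its point on the listed
coordinates; `val c` recovers an index from the trace. -/
theorem exists_codes (L K X : Type u) [Infinite L] [Infinite K] (hX : #X ≤ 2 ^ #K)
    (hK : #K ≤ 2 ^ #L) :
    ∃ (Code : Type u) (val : Code → X → L), Nonempty Code ∧ #Code ≤ 2 ^ #L ∧
      ∀ s : L → X, ∃ c, InjOn (val c) (range s) := by
  classical
  rw [← mk_set] at hX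
  obtain ⟨e⟩ := hX
  have a₀ : L := Classical.arbitrary L
  let Code := (L × L → K) × (L → Set (L × L))
  let val (c : Code) (η : X) : L :=
    if h : ∃ i, c.2 i = {p | c.1 p ∈ e η} then h.choose else a₀
  refine ⟨Code, val, inferInstance, ?_, fun s => ?_⟩
  · have hL : ℵ₀ ≤ #L := aleph0_le_mk L
    have h1 : #(L × L → K) ≤ 2 ^ #L := by
      simp only [← power_def, mk_prod, lift_id, mul_eq_self hL]
      calc #K ^ #L ≤ (2 ^ #L) ^ #L := power_le_power_right hK
        _ = 2 ^ #L := by rw [← power_mul, mul_eq_self hL]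
    have h2 : #(L → Set (L × L)) ≤ 2 ^ #L := by
      simp only [← power_def, mk_set, mk_prod, lift_id, mul_eq_self hL, ← power_mul, le_refl]
    calc #Code = #(L × L → K) * #(L → Set (L × L)) := by simp only [Code, mk_prod, lift_id]
      _ ≤ 2 ^ #L * 2 ^ #L := mul_le_mul' h1 h2
      _ = 2 ^ #L := mul_eq_self (hL.trans (cantor _).le)
  · have hd (p : L × L) : ∃ k, s p.1 ≠ s p.2 → ¬ (k ∈ e (s p.1) ↔ k ∈ e (s p.2)) := by
      by_contra! hcon
      have k₀ : K := Classical.arbitrary K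
      exact (hcon k₀).1 (e.injective (Set.ext fun k => (hcon k).2))
    choose q hq using hd
    let c : Code := (q, fun i => {p | q p ∈ e (s i)})
    have hval (i : L) : {p | q p ∈ e (s (val c (s i)))} = {p | q p ∈ e (s i)} := by
      have hex : ∃ j, c.2 j = {p | c.1 p ∈ e (s i)} := ⟨i, rfl⟩
      have h : val c (s i) = hex.choose := dif_pos hex
      rw [h]
      exact hex.choose_spec
    refine ⟨c, ?_⟩
    rintro _ ⟨i, rfl⟩ _ ⟨j, rfl⟩ h
    by_contra hne
    apply hq (i, j) hne
    have h' := (hval i).symm.trans ((congrArg (fun x => {p | q p ∈ e (s x)}) h).trans (hval j))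
    exact iff_of_eq (congrArg ((i, j) ∈ ·) h')

/-! ### The tree of formal limits -/

/-- Well-founded trees whose inner nodes carry a label in `J` and an `L`-indexed sequence of
subtrees. They are the points of the space: `node j g` serves as the `j`-th limit of the sequence
`g`. -/
inductive LimitTree (L J : Type u) : Type u
  | base : LimitTree L J
  | node : J → (L → LimitTree L J) → LimitTree L J

namespace LimitTree

variable {L J : Type u}

/-- The sequence of immediate subtrees, with the convention that those of `base` are `base`. -/
def children : LimitTree L J → L → LimitTree L J
  | base => fun _ => base
  | node _ g => g

theorem mk_eq (h : #J ^ #L = #J) (hJ : ℵ₀ ≤ #J) : #(LimitTree L J) = #J := by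
  apply le_antisymm
  · let β : Option J → Type u := fun o => o.elim PEmpty fun _ => L
    let toW : LimitTree L J → WType β := fun t =>
      t.rec ⟨none, PEmpty.elim⟩ fun j _ ih => ⟨some j, ih⟩
    have hinj : toW.Injective := by
      intro a
      induction a with
      | base =>
        rintro (_ | ⟨j, g⟩) h
        · rfl
        · injection h with h1; cases h1
      | node j g ih =>
        rintro (_ | ⟨k, f⟩) h
        · injection h with h1; cases h1
        · injection h with h1 h2
          cases h1
          congr 1
          funext i
          exact ih i (congrFun h2 i)
    refine (mk_le_of_injective hinj).trans (WType.cardinalMk_le_of_le ?_)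
    have hle (o : Option J) : #J ^ #(β o) ≤ #J := by
      cases o with
      | none => simpa [β] using one_le_aleph0.trans hJ
      | some j => exact h.le
    refine (sum_le_sum _ (fun _ => #J) hle).trans ?_
    rw [sum_const', mk_option, add_one_eq hJ, mul_eq_self hJ]
  · exact mk_le_of_injective (f := fun j => node j fun _ => base) fun a b hab => by
      injection hab

/-- The hereditary closure of a tree has at most `#L` elements. -/
theorem exists_range_closed [Infinite L] (t : LimitTree L J) :
    ∃ s : L → LimitTree L J, t ∈ range s ∧ ∀ η ∈ range s, ∀ i, children η i ∈ range s := by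
  have a₀ : L := Classical.arbitrary L
  induction t with
  | base => exact ⟨fun _ => base, ⟨a₀, rfl⟩, by rintro _ ⟨_, rfl⟩ i; exact ⟨a₀, rfl⟩⟩
  | node j g ih =>
    choose s hs hcl using ih
    have hle : #(Option (L × L)) ≤ #L := by simp
    obtain ⟨φ⟩ := hle
    have hσ := Function.invFun_surjective φ.injective
    set σ := Function.invFun φ
    refine ⟨fun l => (σ l).elim (node j g) fun p => s p.1 p.2, ?_, ?_⟩
    · obtain ⟨l, hl⟩ := hσ none
      exact ⟨l, by simp [hl]⟩
    · have hsub (i : L) : range (s i) ⊆ range fun l => (σ l).elim (node j g) fun p => s p.1 p.2 := by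
        rintro _ ⟨l', rfl⟩
        obtain ⟨l, hl⟩ := hσ (some (i, l'))
        exact ⟨l, by simp [hl]⟩
      rintro _ ⟨l, rfl⟩ i
      dsimp only
      cases h : σ l with
      | none => exact hsub i (hs i)
      | some p => exact hsub p.1 (hcl p.1 _ ⟨p.2, rfl⟩ i)

variable (D : LimitTree L J → Ultrafilter L)

/-- Sets for which every tree with pairwise distinct children behaves as the limit of its children
along its ultrafilter. -/
def IsLimitCompatible (U : Set (LimitTree L J)) : Prop :=
  ∀ η, (children η).Injective → (η ∈ U ↔ ∀ᶠ i in (D η : Filter L), children η i ∈ U)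

variable {D}

theorem IsLimitCompatible.compl {U : Set (LimitTree L J)} (hU : IsLimitCompatible D U) :
    IsLimitCompatible D Uᶜ := fun η hη => by
  simp only [mem_compl_iff, Ultrafilter.eventually_not, hU η hη]

theorem IsLimitCompatible.inter {U V : Set (LimitTree L J)} (hU : IsLimitCompatible D U)
    (hV : IsLimitCompatible D V) : IsLimitCompatible D (U ∩ V) := fun η hη => by
  simp only [mem_inter_iff, Filter.eventually_and, hU η hη, hV η hη]

theorem isLimitCompatible_univ : IsLimitCompatible D univ := fun η _ => by simp

/-- The set obtained from the values of `P` on `S` by taking limits along the ultrafilters at the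
trees outside `S`. -/
def extend (D : LimitTree L J → Ultrafilter L) (S : Set (LimitTree L J))
    (P : LimitTree L J → Prop) : LimitTree L J → Prop
  | base => P base
  | node j g => (node j g ∈ S ∧ P (node j g)) ∨
      (node j g ∉ S ∧ ∀ᶠ i in (D (node j g) : Filter L), extend D S P (g i))

/-- A limit-compatible predicate on a hereditary set extends to the whole space. -/
theorem exists_isLimitCompatible_of_hereditary [Nontrivial L] {S : Set (LimitTree L J)}
    (hS : ∀ η ∈ S, ∀ i, children η i ∈ S) {P : LimitTree L J → Prop}
    (hP : ∀ η ∈ S, (children η).Injective →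
      (P η ↔ ∀ᶠ i in (D η : Filter L), P (children η i))) :
    ∃ U, IsLimitCompatible D U ∧ ∀ η ∈ S, (η ∈ U ↔ P η) := by
  have h (η) (hη : η ∈ S) : extend D S P η ↔ P η := by
    cases η with
    | base => simp [extend]
    | node j g => simp [extend, hη]
  refine ⟨{η | extend D S P η}, fun η hinj => ?_, h⟩
  by_cases hη : η ∈ S
  · simp only [mem_ofPred_eq, h η hη, h _ (hS η hη _)]
    exact hP η hη hinj
  · cases η with
    | base =>
      obtain ⟨a, b, hab⟩ := exists_pair_ne L
      exact absurd (@hinj a b rfl) hab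
    | node j g => simp [extend, hη, children]

/-! ### Separating points -/

/-- Two points of a hereditary set `range s` are separated by a limit-compatible set. Thinning out
the children of each `η` to those which guess `v η` and sit at closure points beyond an index of
`η` leaves the descent relation with at most one parent for each tree, so the trees reachable from
one point form a compatible set avoiding the other. -/
theorem exists_isLimitCompatible_separating [LinearOrder L] (hL : IsUncountableRegularOrder L)
    (hD : ∀ η F, closurePoints F ∈ D η) {s : L → LimitTree L J}
    (hs : ∀ η ∈ range s, ∀ i, children η i ∈ range s) {v : LimitTree L J → L}
    (hv : InjOn v (range s)) {G : L → L} (hG : ∀ η, ∀ᶠ i in (D η : Filter L), G i = v η)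
    {ξ ζ : LimitTree L J} (hξ : ξ ∈ range s) (hζ : ζ ∈ range s) (hne : ξ ≠ ζ) :
    ∃ U, IsLimitCompatible D U ∧ ζ ∈ U ∧ ξ ∉ U := by
  have := hL.infinite
  have htail (η : LimitTree L J) (a : L) : ∀ᶠ i in (D η : Filter L), a < i := by
    filter_upwards [hD η fun _ => a] with i hi
    exact hi.2 _ hi.1.choose_spec
  have hchild (η t : LimitTree L J) (hη : (children η).Injective) :
      ∀ᶠ i in (D η : Filter L), children η i ≠ t := by
    by_cases ht : ∃ a, children η a = t
    · obtain ⟨a, rfl⟩ := ht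
      filter_upwards [htail η a] with i hi h
      exact hi.ne' (hη h)
    · exact .of_forall fun i h => ht ⟨i, h⟩
  obtain ⟨F, hF⟩ := hL.exists_closurePoints_disjoint fun ε => children (s ε)
  let R (η t : LimitTree L J) : Prop := (children η).Injective ∧ t ≠ ξ ∧ t ≠ ζ ∧
    ∃ γ ∈ closurePoints F, children η γ = t ∧ G γ = v η ∧ ∃ ε < γ, s ε = η
  have huniq {η η' t : LimitTree L J} (h : R η t) (h' : R η' t) : η = η' := by
    obtain ⟨hi, -, -, γ, hγ, rfl, hGγ, ε, hε, rfl⟩ := h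
    obtain ⟨hi', -, -, δ, hδ, heq, hGδ, ε', hε', rfl⟩ := h'
    obtain rfl := hF ε ε' γ δ hi hi' hγ hδ hε hε' heq.symm
    exact hv ⟨_, rfl⟩ ⟨_, rfl⟩ (hGγ.symm.trans hGδ)
  have hstep {η t : LimitTree L J} (h : R η t) :
      Relation.ReflTransGen R ζ t ↔ Relation.ReflTransGen R ζ η := by
    refine ⟨fun ht => ?_, fun hη => hη.tail h⟩
    obtain rfl | ⟨η', hη', h'⟩ := ht.cases_tail
    · exact absurd rfl h.2.2.1
    · rwa [huniq h h']
  obtain ⟨U, hU, hUP⟩ := exists_isLimitCompatible_of_hereditary (D := D) hs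
    (P := Relation.ReflTransGen R ζ) fun η hη hinj => by
      obtain ⟨ε, rfl⟩ := hη
      have hev : ∀ᶠ i in (D (s ε) : Filter L), R (s ε) (children (s ε) i) := by
        filter_upwards [hchild _ ξ hinj, hchild _ ζ hinj, hD (s ε) F, hG (s ε), htail (s ε) ε]
          with i h1 h2 h3 h4 h5
        exact ⟨hinj, h1, h2, i, h3, rfl, h4, ε, h5, rfl⟩
      rw [Filter.eventually_congr (hev.mono fun i hi => hstep hi), Filter.eventually_const]
  refine ⟨U, hU, (hUP ζ hζ).2 .refl, fun hmem => ?_⟩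
  obtain h | ⟨η, -, h⟩ := ((hUP ξ hξ).1 hmem).cases_tail
  · exact hne h
  · exact h.2.1 rfl

end LimitTree

/-! ### The topology -/

/-- A family of sets closed under complements and finite intersections generates a topology whose
clopen sets form a basis. -/
theorem isTopologicalBasis_isClopen_generateFrom {X : Type u} {B : Set (Set X)}
    (huniv : Set.univ ∈ B) (hcompl : ∀ U ∈ B, Uᶜ ∈ B) (hinter : ∀ U ∈ B, ∀ V ∈ B, U ∩ V ∈ B) :
    let _ := TopologicalSpace.generateFrom B
    TopologicalSpace.IsTopologicalBasis B ∧
      TopologicalSpace.IsTopologicalBasis {U : Set X | IsClopen U} := by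
  intro _
  have hB : TopologicalSpace.IsTopologicalBasis B :=
    ⟨fun U hU V hV x hx => ⟨U ∩ V, hinter U hU V hV, hx, subset_rfl⟩,
      sUnion_eq_univ_iff.2 fun x => ⟨_, huniv, mem_univ x⟩, rfl⟩
  refine ⟨hB, TopologicalSpace.isTopologicalBasis_of_isOpen_of_nhds (fun U hU => hU.isOpen) ?_⟩
  intro x U hx hU
  obtain ⟨V, hV, hxV, hVU⟩ := hB.exists_subset_of_mem_open hx hU
  exact ⟨V, ⟨⟨hB.isOpen (hcompl V hV)⟩, hB.isOpen hV⟩, hxV, hVU⟩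

theorem theorem1p1 (lam mu kap : Cardinal.{u})
    (hreg : lam.IsRegular) (hunc : Cardinal.aleph0 < lam)
    (hmu : mu = (2 : Cardinal.{u}) ^ lam)
    (hkap : IsLeast {c : Cardinal.{u} | mu < (2 : Cardinal.{u}) ^ c} kap) :
    ∃ (X : Type u) (_ : TopologicalSpace X),
      T2Space X ∧
      TopologicalSpace.IsTopologicalBasis {U : Set X | IsClopen U} ∧
      Cardinal.mk X = (2 : Cardinal.{u}) ^ kap ∧
      ∀ Y : Set X, IsClosed Y → Cardinal.mk Y < Cardinal.mk X → Cardinal.mk Y < lam := by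
  subst hmu
  have hlk : lam < kap := by
    by_contra! hle
    exact absurd hkap.1 (not_lt.2 (power_le_power_left two_ne_zero hle))
  have hk : kap ≤ 2 ^ lam := hkap.2 (cantor _)
  have hk₀ : ℵ₀ ≤ kap := (hunc.trans hlk).le
  set L := lam.ord.ToType
  have hL : IsUncountableRegularOrder L := isUncountableRegularOrder_ord hreg hunc
  have hLlam : #L = lam := mk_ord_toType lam
  have := hL.infinite
  obtain ⟨K, rfl⟩ : ∃ K : Type u, #K = kap := ⟨_, mk_out kap⟩
  have : Infinite K := infinite_iff.2 hk₀
  let J := Set K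
  have hJ : #J = 2 ^ #K := mk_set
  have hJ₀ : ℵ₀ ≤ #J := hJ ▸ hk₀.trans (cantor _).le
  have hX : #(LimitTree L J) = 2 ^ #K :=
    (LimitTree.mk_eq (by rw [hJ, hLlam, ← power_mul, mul_eq_left hk₀ hlk.le hreg.pos.ne']) hJ₀).trans
      hJ
  obtain ⟨Code, val, _, hC, hval⟩ := exists_codes L K (LimitTree L J) hX.le (by rwa [hLlam])
  obtain ⟨G, hG⟩ := hL.exists_guessing hC
  choose D hD hDG using fun η => exists_ultrafilter_guessing hG fun c => val c η
  obtain ⟨hB, hclopen⟩ := isTopologicalBasis_isClopen_generateFrom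
    (B := {U | LimitTree.IsLimitCompatible D U}) LimitTree.isLimitCompatible_univ
    (fun _ hU => hU.compl) fun _ hU _ hV => hU.inter hV
  let _ := TopologicalSpace.generateFrom {U | LimitTree.IsLimitCompatible D U}
  refine ⟨LimitTree L J, inferInstance,
    ⟨fun ξ ζ hne => ?_⟩, hclopen, hX, fun Y hY hlt => ?_⟩
  · -- The children of an auxiliary node put both points into one hereditary set.
    obtain ⟨a, b, hab⟩ := exists_pair_ne L
    classical
    obtain ⟨s, ht, hs⟩ := LimitTree.exists_range_closed
      (LimitTree.node (∅ : J) fun i => if i = a then ξ else ζ : LimitTree L J)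
    have hξ : ξ ∈ range s := by simpa [LimitTree.children] using hs _ ht a
    have hζ : ζ ∈ range s := by simpa [LimitTree.children, hab.symm] using hs _ ht b
    obtain ⟨c, hc⟩ := hval s
    obtain ⟨U, hU, hζU, hξU⟩ := LimitTree.exists_isLimitCompatible_separating hL hD hs hc
      (fun η => hDG η c) hξ hζ hne
    exact ⟨Uᶜ, U, hB.isOpen hU.compl, hB.isOpen hU, hξU, hζU, disjoint_compl_left⟩
  · by_contra! hle
    rw [← hLlam] at hle
    obtain ⟨g⟩ := hle
    refine absurd hlt (not_lt.2 ?_)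
    -- A closed set containing an injective sequence contains all of its `#J` many limits.
    have hmem (j : J) : LimitTree.node j (fun i => (g i : LimitTree L J)) ∈ Y := by
      by_contra hnot
      obtain ⟨U, hU, hηU, hUY⟩ := hB.exists_subset_of_mem_open (u := Yᶜ) hnot hY.isOpen_compl
      have hev := (hU (.node j fun i => (g i : LimitTree L J))
        (Subtype.val_injective.comp g.injective)).1 hηU
      obtain ⟨i, hi⟩ := hev.exists
      exact hUY hi (g i).2
    rw [hX, ← hJ]
    refine mk_le_of_injective (f := fun j => (⟨_, hmem j⟩ : Y)) fun j k hjk => ?_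
    have h := Subtype.ext_iff.1 hjk
    injection h
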